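/- Alphabets $\Sigma,\Gamma$ are finite. A transducer $\mathcal T$ has a finite state set $Q$ partitioned into input states $Q_i$ and output states, an initial state $q_0$, finitely many transitions $(p,u,v,q)$ with $v\in\Gamma^*$, where $u$ is a single letter of $\Sigma$ if $p\in Q_i$ and $u=\varepsilon$ otherwise, and priorities $c\colon Q\to\mathbb N$. Write $\mathcal T\colon p\xrightarrow{u/v}q$ if a finite run from $p$ to $q$ reads $u$ and outputs $v$ (the empty run $p\xrightarrow{\varepsilon/\varepsilon}p$ is allowed). $R(\mathcal T)\subseteq\Sigma^\omega\times\Gamma^\omega$ is the set of pairs $(\alpha,\beta)$ that label an infinite run from $q_0$ on which the maximal priority occurring infinitely often is even. $\mathcal T$ has property $\mathcal P$ if for all $u\in\Sigma^*$ and all $v,v'\in\Gamma^*$ such that $v$ is a prefix of $v'$: if $\mathcal T\colon q_0\xrightarrow{u/v}p\in Q_i$ and $\mathcal T\colon q_0\xrightarrow{u/v'}q\in Q_i$, then $p=q$. A partial function $f\colon\Sigma^\omega\to\Gamma^\omega$ uniformizes $R$ if $\mathrm{dom}(f)=\mathrm{dom}(R)$ and $(\alpha,f(\alpha))\in R$ for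 all $\alpha\in\mathrm{dom}(f)$. It is continuous if for all $\alpha\in\mathrm{dom}(f)$ and $i\in\mathbb N$ there is $j\in\mathbb N$ such that for all $\beta\in\mathrm{dom}(f)$: $|\alpha\wedge\beta|\ge j$ implies $|f(\alpha)\wedge f(\beta)|\ge i$, where $\wedge$ is the longest common prefix. It is computable if there is a deterministic Turing machine with a one-way read-only input tape, a two-way working tape and a one-way write-only output tape that, for every input $\alpha\in\mathrm{dom}(f)$, has at all times a prefix of $f(\alpha)$ on its output tape, the length of which tends to infinity. The profile of $u\in\Sigma^*$ is the set $P_u$ of all $(p,q,m)$ such that for some $v$ there is a run $\mathcal T\colon p\xrightarrow{u/v}q$ with maximal visited priority $m$ ($p$ and $q$ count as visited), and $P\otimes P'=\{(p,r,\max(m,n)) : (p,q,m)\in P,\ (q,r,n)\in P' \text{ for some } q\}$. Let $\mathcal D$ be a (complete) deterministic parity automaton with initial state $r_0$, transition function $\delta$ and priorities $c_{\mathcal D}$ that recognizes $\mathrm{dom}(R(\mathcal T))$. The game $\mathcal G_{\mathcal T}$ has vertices $(q,c,P_1,P_2,r,X)$ with $q\in Q$, $c$ a priority of $\mathcal T$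 or $-1$, sets of triples $P_1,P_2$, a state $r$ of $\mathcal D$, and the player $X\in\{\forall,\exists\}$ (Adam, Eve) to move. It starts in $(q_0,-1,P_\varepsilon,P_\varepsilon,r_0,\forall)$ and has the edges - $(q,c,P_1,P_2,r,\forall)\to(q,-1,P_1,P_2\otimes P_a,\delta(r,a),\exists)$ for $a\in\Sigma$; - $(q,c,P_1,P_2,r,\exists)\to(q,-1,P_1,P_2,r,\forall)$ (skip); - $(q,c,P_1,P_2,r,\exists)\to(q',m,P_2,P_\varepsilon,r,\forall)$ for $(q,q',m)\in P_1$ (produce). Eve wins a play if the following holds: if the maximal $c_{\mathcal D}(r)$ that occurs infinitely often in it is even, then so is the maximal $c$ that occurs infinitely often in it. **Theorem.** Let $R=R(\mathcal T)$ for a transducer $\mathcal T$ with property $\mathcal P$. If $R$ is uniformized by a continuous function, then Eve has a winning strategy in $\mathcal G_{\mathcal T}$ (for every choice of $\mathcal D$). In particular, if $R$ is uniformized by a computable function, then Eve has a winning strategy in $\mathcal G_{\mathcal T}$. -/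

import Mathlib

namespace OmegaSynth

/-! ### Infinite words -/

/-- Infinite words over `A`, position `0` being the first letter. -/
abbrev OmegaWord (A : Type*) := ℕ → A

/-- The prefix of length `k` of an infinite word. -/
def OmegaWord.pref {A : Type*} (α : OmegaWord A) (k : ℕ) : List A :=
  (List.range k).map α

/-- The finite word `u` is a prefix of the infinite word `α`. -/
def IsOmegaPrefix {A : Type*} (u : List A) (α : OmegaWord A) : Prop :=
  u = OmegaWord.pref α u.length

/-- The longest common prefix of `α` and `β` has length at least `j`. -/
def AgreeUpTo {A : Type*} (j : ℕ) (α β : OmegaWord A) : Prop :=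
  ∀ k < j, α k = β k

/-- `u 0 ++ u 1 ++ ⋯ ++ u (n - 1)`. -/
def blocks {A : Type*} (u : ℕ → List A) : ℕ → List A
  | 0 => []
  | n + 1 => blocks u n ++ u n

/-- The infinite concatenation `u 0 · u 1 · u 2 ⋯` is the infinite word `α`. -/
def IsInfConcat {A : Type*} (u : ℕ → List A) (α : OmegaWord A) : Prop :=
  (∀ n, IsOmegaPrefix (blocks u n) α) ∧ ∀ N, ∃ n, N ≤ (blocks u n).length

/-- The set of values that a sequence takes infinitely often. -/
def infOcc {C : Type*} (s : ℕ → C) : Set C :=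
  {k | ∃ᶠ n in Filter.atTop, s n = k}

/-- `max Inf(s)` exists and is even. -/
def MaxInfEven {C : Type*} [LinearOrder C] [Add C] (s : ℕ → C) : Prop :=
  ∃ k, IsGreatest (infOcc s) k ∧ Even k

/-! ### Relations, uniformization, continuity -/

/-- The domain of a relation between infinite words. -/
def relDom {A B : Type*} (R : Set (OmegaWord A × OmegaWord B)) : Set (OmegaWord A) :=
  {α | ∃ β, (α, β) ∈ R}

/-- The partial function `f` uniformizes `R`: it has the same domain and its graph is
contained in `R`. -/
def Uniformizes {A B : Type*} (f : OmegaWord A →. OmegaWord B)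
    (R : Set (OmegaWord A × OmegaWord B)) : Prop :=
  f.Dom = relDom R ∧ ∀ α x, x ∈ f α → (α, x) ∈ R

/-- Continuity of a partial function on infinite words: for every `α ∈ dom f` and every `i`
there is `j` such that for all `β ∈ dom f`, `|α ∧ β| ≥ j` implies `|f α ∧ f β| ≥ i`. -/
def IsContinuousFn {A B : Type*} (f : OmegaWord A →. OmegaWord B) : Prop :=
  ∀ α x, x ∈ f α → ∀ i, ∃ j, ∀ β y, y ∈ f β → AgreeUpTo j α β → AgreeUpTo i x y

/-! ### Computability of functions on infinite words -/

/-- Deterministic Turing machines with a one-way read-only input tape (with a left delimiter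
and an infinite word on it), a two-way working tape and a one-way write-only output tape. The
transition function sees the state, the symbol under the input head (`none` is the left
delimiter) and the symbol under the working head; it gives the new state, the symbol written
on the working tape, the move of the working head (`none`: no move), whether the input head
advances by one cell, and the letter appended to the output (`none`: no letter). -/
structure OmegaMachine (A B : Type*) where
  State : Type
  Work : Type
  [finState : Finite State]
  [finWork : Finite Work]
  [blank : Inhabited Work]
  start : State
  trans : State → Option A → Work → State × Work × Option Turing.Dir × Bool × Option B

attribute [instance] OmegaMachine.finState OmegaMachine.finWork OmegaMachine.blank

/-- Configurations: `pos` is the number of input letters read so far. -/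
structure OmegaMachine.Config {A B : Type*} (M : OmegaMachine A B) where
  state : M.State
  pos : ℕ
  work : Turing.Tape M.Work
  out : List B

/-- The symbol of the input tape in cell `n`; cell `0` holds the left delimiter. -/
def inputCell {A : Type*} (α : OmegaWord A) : ℕ → Option A
  | 0 => none
  | n + 1 => some (α n)

/-- One step of the machine on the input word `α`. -/
def OmegaMachine.next {A B : Type*} (M : OmegaMachine A B) (α : OmegaWord A)
    (c : M.Config) : M.Config :=
  match M.trans c.state (inputCell α c.pos) c.work.head with
  | (s, w, d, adv, o) =>
    { state := s
      pos := if adv then c.pos + 1 else c.pos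
      work :=
        match d with
        | none => c.work.write w
        | some d => (c.work.write w).move d
      out := c.out ++ o.toList }

/-- The configuration after `t` steps on the input word `α`. -/
def OmegaMachine.configAt {A B : Type*} (M : OmegaMachine A B) (α : OmegaWord A) :
    ℕ → M.Config
  | 0 => { state := M.start, pos := 0, work := Turing.Tape.mk₁ [], out := [] }
  | t + 1 => M.next α (M.configAt α t)

/-- The partial function `f` is computable: some machine, run on any `α ∈ dom f`, has at any
time a prefix of `f α` on its output tape, and this output grows beyond all bounds. -/
def IsComputableFn {A B : Type*} (f : OmegaWord A →. OmegaWord B) : Prop :=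
  ∃ M : OmegaMachine A B, ∀ α x, x ∈ f α →
    (∀ t, IsOmegaPrefix (M.configAt α t).out x) ∧ ∀ j, ∃ t, j ≤ (M.configAt α t).out.length

/-! ### Deterministic parity automata -/

/-- (Complete) deterministic parity automata over `A` with state set `S`. -/
structure DPA (A S : Type*) where
  start : S
  step : S → A → S
  color : S → ℕ

/-- The run of the automaton on an infinite word. -/
def DPA.run {A S : Type*} (D : DPA A S) (α : OmegaWord A) : ℕ → S
  | 0 => D.start
  | n + 1 => D.step (D.run α n) (α n)

/-- The language of infinite words recognized by the automaton. -/
def DPA.language {A S : Type*} (D : DPA A S) : Set (OmegaWord A) :=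
  {α | MaxInfEven fun n => D.color (D.run α n)}

/-! ### Transducers -/

/-- Nondeterministic parity transducers with state set `Q`, input alphabet `A`, output
alphabet `B`. The states are partitioned into input states and output states (the states
outside `inputStates`); a transition `(p, u, v, q)` from an input state reads exactly one
input letter, one from an output state reads none. -/
structure Transducer (A B Q : Type*) where
  start : Q
  inputStates : Set Q
  Δ : Set (Q × List A × List B × Q)
  finite_Δ : Δ.Finite
  input_reads : ∀ p u v q, (p, u, v, q) ∈ Δ → p ∈ inputStates → u.length = 1
  output_reads : ∀ p u v q, (p, u, v, q) ∈ Δ → p ∉ inputStates → u = []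
  color : Q → ℕ

namespace Transducer

variable {A B Q : Type*}

/-- `T.Run p u v q m`: there is a finite run from `p` to `q` with input `u` and output `v`
on which the maximal priority of a visited state (`p` and `q` included) is `m`. -/
inductive Run (T : Transducer A B Q) : Q → List A → List B → Q → ℕ → Prop
  | nil (p : Q) : Run T p [] [] p (T.color p)
  | cons {p q r : Q} {u u' : List A} {v v' : List B} {m : ℕ} :
      (p, u, v, q) ∈ T.Δ → Run T q u' v' r m →
      Run T p (u ++ u') (v ++ v') r (max (T.color p) m)

/-- `Δ*(p, u/v)`: the states reachable from `p` by a run with input `u` and output `v`. -/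
def reach (T : Transducer A B Q) (p : Q) (u : List A) (v : List B) : Set Q :=
  {q | ∃ m, T.Run p u v q m}

/-- The relation recognized by `T`: the pairs `(α, β)` of infinite words for which there is an
infinite run from the initial state with input `α` and output `β` that satisfies the parity
condition. -/
def relation (T : Transducer A B Q) : Set (OmegaWord A × OmegaWord B) :=
  {x | ∃ (ρ : ℕ → Q) (u : ℕ → List A) (v : ℕ → List B),
    ρ 0 = T.start ∧ (∀ n, (ρ n, u n, v n, ρ (n + 1)) ∈ T.Δ) ∧
    IsInfConcat u x.1 ∧ IsInfConcat v x.2 ∧ MaxInfEven fun n => T.color (ρ n)}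

/-- An input prefix together with an output prefix determines the state from which the next
input letter is read: input states that are reached on the same input with outputs one of
which is a prefix of the other are equal. -/
def HasPropertyP (T : Transducer A B Q) : Prop :=
  ∀ (u : List A) (v w : List B) (p q : Q), v <+: w →
    p ∈ T.reach T.start u v → p ∈ T.inputStates →
    q ∈ T.reach T.start u w → q ∈ T.inputStates → p = q

/-- The profile of the input word `u`: the triples `(p, q, m)` for which some run from `p` to
`q` reads `u`, with any output, and has maximal priority `m`. -/
def profile (T : Transducer A B Q) (u : List A) : Set (Q × Q × ℕ) :=
  {x | ∃ v, T.Run x.1 u v x.2.1 x.2.2}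

end Transducer

/-- The product of two profiles. -/
def profileMul {Q : Type*} (P P' : Set (Q × Q × ℕ)) : Set (Q × Q × ℕ) :=
  {x | ∃ q m n, (x.1, q, m) ∈ P ∧ (q, x.2.1, n) ∈ P' ∧ x.2.2 = max m n}

/-! ### Infinite two-player games -/

/-- The two players. -/
inductive Player
  | adam
  | eve

/-- Turn-based infinite games on a graph with vertex set `V`. -/
structure Game (V : Type*) where
  init : V
  owner : V → Player
  Edge : V → V → Prop
  win : Set (ℕ → V)

namespace Game

variable {V : Type*}

/-- The plays of the game: infinite paths from the initial vertex. -/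
def IsPlay (G : Game V) (γ : ℕ → V) : Prop :=
  γ 0 = G.init ∧ ∀ n, G.Edge (γ n) (γ (n + 1))

/-- `h` is a finite path from the initial vertex to `v`. -/
def IsHistory (G : Game V) (h : List V) (v : V) : Prop :=
  h.IsChain G.Edge ∧ h.head? = some G.init ∧ h.getLast? = some v

/-- `σ`, which maps a history to the next vertex, is a strategy of Eve: it follows an edge
after every history that ends in a vertex of Eve. -/
def IsEveStrategy (G : Game V) (σ : List V → V) : Prop :=
  ∀ h v, G.IsHistory h v → G.owner v = Player.eve → G.Edge v (σ h)

/-- The play `γ` is played according to the strategy `σ` of Eve. -/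
def Consistent (G : Game V) (σ : List V → V) (γ : ℕ → V) : Prop :=
  ∀ n, G.owner (γ n) = Player.eve → γ (n + 1) = σ ((List.range (n + 1)).map γ)

/-- Eve has a winning strategy from the initial vertex. -/
def EveHasWinningStrategy (G : Game V) : Prop :=
  ∃ σ, G.IsEveStrategy σ ∧ ∀ γ, G.IsPlay γ → G.Consistent σ γ → γ ∈ G.win

end Game

/-! ### The delay game of a transducer -/

/-- Vertices `(q, c, P₁, P₂, r, player)`: the current state `q` of the transducer, the
priority `c` of the last move (`-1` if nothing was produced), the two profiles of the
lookahead, the state `r` of the domain automaton, and the player to move. -/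
structure Vertex (Q S : Type*) where
  state : Q
  color : ℤ
  P₁ : Set (Q × Q × ℕ)
  P₂ : Set (Q × Q × ℕ)
  dom : S
  player : Player

/-- Adam gives an input letter, which extends the second profile; then Eve skips or takes a
producing edge, which applies a state transformation from the first profile. -/
inductive DelayEdge {A B Q S : Type*} (T : Transducer A B Q) (D : DPA A S) :
    Vertex Q S → Vertex Q S → Prop
  | letter (q c P₁ P₂ r) (a : A) :
      DelayEdge T D ⟨q, c, P₁, P₂, r, Player.adam⟩
        ⟨q, -1, P₁, profileMul P₂ (T.profile [a]), D.step r a, Player.eve⟩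
  | skip (q c P₁ P₂ r) :
      DelayEdge T D ⟨q, c, P₁, P₂, r, Player.eve⟩ ⟨q, -1, P₁, P₂, r, Player.adam⟩
  | produce (q c P₁ P₂ r) (q' : Q) (m : ℕ) (h : (q, q', m) ∈ P₁) :
      DelayEdge T D ⟨q, c, P₁, P₂, r, Player.eve⟩
        ⟨q', (m : ℤ), P₂, T.profile [], r, Player.adam⟩

/-- The finite-state delay game of `T`, where `D` is an automaton for the domain of the
relation of `T`. A play `γ` is won by Eve if
`max Inf(col_D γ)` even implies `max Inf(col_T γ)` even. -/
def delayGame {A B Q S : Type*} (T : Transducer A B Q) (D : DPA A S) :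
    Game (Vertex Q S) where
  init := ⟨T.start, -1, T.profile [], T.profile [], D.start, Player.adam⟩
  owner := Vertex.player
  Edge := DelayEdge T D
  win := {γ | MaxInfEven (fun n => D.color (γ n).dom) → MaxInfEven (fun n => (γ n).color)}

end OmegaSynth

namespace OmegaSynth

/-! ### Words and priorities -/

/-! Let `f` be a continuous uniformizer. While Adam spells a word `α`, Eve tries to trace an
accepting run of the transducer on `(α, f α)`, lagging two blocks of input behind. She does not know
this run, but property P fixes the input state in which it stands at each input position
(`AtInput.eq`), and continuity lets a finite prefix of `α` decide that state
(`AtInput.exists_agreeUpTo`). So she skips until all words of `dom f` that extend the current input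
agree on the state at the end of the first profile, then moves there with the best priority on offer
(`IsGoodMove`, `eveMove`).

If the domain automaton accepts, then `α ∈ dom f`, and the play can be compared afterwards with an
arbitrary accepting run on `(α, f α)`. Every production lands on a state of that run (`follows`).
The maximum of the run on the traced segment was itself on offer, so the chosen priority is at least
as good (`move_dominates`). Continuity makes productions occur infinitely often (`exists_color_ne`),
hence the whole run is traced (`exists_le_runTime`), and `maxInfEven_of_dominates` transfers the
parity condition to the play. Computable functions are covered because they are continuous. -/

theorem OmegaWord.pref_succ {A : Type*} (α : OmegaWord A) (k : ℕ) :
    α.pref (k + 1) = α.pref k ++ [α k] := by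
  simp [OmegaWord.pref, List.range_succ]

@[simp]
theorem OmegaWord.length_pref {A : Type*} (α : OmegaWord A) (k : ℕ) :
    (α.pref k).length = k := by
  simp [OmegaWord.pref]

theorem AgreeUpTo.mono {A : Type*} {i j : ℕ} {α β : OmegaWord A} (h : AgreeUpTo j α β)
    (hij : i ≤ j) : AgreeUpTo i α β :=
  fun k hk => h k (hk.trans_le hij)

theorem AgreeUpTo.pref_eq {A : Type*} {j : ℕ} {α β : OmegaWord A} (h : AgreeUpTo j α β) :
    α.pref j = β.pref j :=
  List.map_congr_left fun k hk => h k (List.mem_range.1 hk)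

theorem agreeUpTo_of_pref_eq {A : Type*} {j : ℕ} {α β : OmegaWord A}
    (h : α.pref j = β.pref j) : AgreeUpTo j α β :=
  fun k hk => List.map_inj_left.1 h k (List.mem_range.2 hk)

theorem OmegaWord.pref_prefix {A : Type*} (α : OmegaWord A) {i j : ℕ} (h : i ≤ j) :
    α.pref i <+: α.pref j := by
  induction j, h using Nat.le_induction with
  | base => exact List.prefix_rfl
  | succ j _ ih => exact ih.trans (by rw [α.pref_succ]; exact List.prefix_append _ _)

/-- Every sequence with values in a finite set takes some value infinitely often,
along any property that holds infinitely often. -/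
theorem exists_frequently_eq {C : Type*} {s : ℕ → C} {F : Set C} (hF : F.Finite)
    {p : ℕ → Prop} (hp : ∃ᶠ n in Filter.atTop, p n) (hs : ∀ n, p n → s n ∈ F) :
    ∃ k ∈ F, ∃ᶠ n in Filter.atTop, p n ∧ s n = k := by
  by_contra hcon
  push Not at hcon
  have h := (Filter.eventually_all_finite hF).2 fun k hk => hcon k hk
  obtain ⟨n, hn, hn'⟩ := (hp.and_eventually h).exists
  exact hn' (s n) (hs n hn) hn rfl

/-- Eventually, a bounded sequence does not exceed the maximal value that it takes infinitely
often. -/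
theorem eventually_le_of_isGreatest {s : ℕ → ℕ} {K M : ℕ} (hs : ∀ n, s n ≤ K)
    (hM : IsGreatest (infOcc s) M) : ∀ᶠ n in Filter.atTop, s n ≤ M := by
  by_contra hcon
  rw [Filter.not_eventually] at hcon
  obtain ⟨k, -, hk⟩ := exists_frequently_eq (s := s) (Set.finite_Iic K) hcon fun n _ => hs n
  have h1 := hM.2 (hk.mono fun n hn => hn.2)
  obtain ⟨n, hn, rfl⟩ := hk.exists
  exact hn h1

/-- One letter costs two moves: after `n` moves, `(n + 1) / 2` letters have been given. Slowing a
sequence down in this way does not change what recurs. -/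
theorem infOcc_comp_half {C : Type*} (g : ℕ → C) :
    infOcc (fun n => g ((n + 1) / 2)) = infOcc g := by
  ext k
  simp only [infOcc, Set.mem_ofPred_eq, Filter.frequently_atTop]
  constructor
  · intro h N
    obtain ⟨n, hn, hk⟩ := h (2 * N)
    exact ⟨(n + 1) / 2, by omega, hk⟩
  · intro h N
    obtain ⟨n, hn, hk⟩ := h N
    exact ⟨2 * n, by omega, by rwa [show (2 * n + 1) / 2 = n by omega]⟩

/-! ### Comparing priorities along segments of a run -/

/-- In a parity condition, the priority `m` is at least as good as `n`. -/
def Dominates (m n : ℕ) : Prop :=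
  (Even n → Even m ∧ n ≤ m) ∧ (Odd m → m ≤ n)

/-- The best priority is the largest even one, or the smallest odd one if no even one is available.
-/
theorem exists_dominates {F : Set ℕ} (hF : F.Finite) (hne : F.Nonempty) :
    ∃ m ∈ F, ∀ n ∈ F, Dominates m n := by
  by_cases h : ∃ m ∈ F, Even m
  · obtain ⟨m, hm, hmax⟩ := Set.exists_max_image {m ∈ F | Even m} id
      (hF.subset (Set.sep_subset _ _)) h
    exact ⟨m, hm.1, fun n hn => ⟨fun he => ⟨hm.2, hmax n ⟨hn, he⟩⟩,
      fun ho => absurd hm.2 (Nat.not_even_iff_odd.2 ho)⟩⟩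
  · obtain ⟨m, hm, hmin⟩ := Set.exists_min_image F id hF hne
    exact ⟨m, hm, fun n hn => ⟨fun he => absurd ⟨n, hn, he⟩ h, fun _ => hmin n hn⟩⟩

/-- `m` is the maximal value of `s` on the interval `[i, j]`. -/
def IsSegMax (s : ℕ → ℕ) (i j m : ℕ) : Prop :=
  (∀ k, i ≤ k → k ≤ j → s k ≤ m) ∧ ∃ k, i ≤ k ∧ k ≤ j ∧ s k = m

theorem IsSegMax.le {s : ℕ → ℕ} {i j m : ℕ} (h : IsSegMax s i j m) : i ≤ j := by
  obtain ⟨k, h1, h2, -⟩ := h.2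
  exact h1.trans h2

theorem isSegMax_self (s : ℕ → ℕ) (i : ℕ) : IsSegMax s i i (s i) :=
  ⟨fun k h1 h2 => by rw [le_antisymm h2 h1], i, le_rfl, le_rfl, rfl⟩

theorem isSegMax_succ (s : ℕ → ℕ) (i : ℕ) : IsSegMax s i (i + 1) (max (s i) (s (i + 1))) := by
  refine ⟨fun k h1 h2 => ?_, ?_⟩
  · obtain rfl | rfl : k = i ∨ k = i + 1 := by omega
    · exact le_max_left _ _
    · exact le_max_right _ _
  · rcases le_total (s i) (s (i + 1)) with h | h
    · exact ⟨i + 1, by omega, le_rfl, (max_eq_right h).symm⟩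
    · exact ⟨i, le_rfl, by omega, (max_eq_left h).symm⟩

theorem IsSegMax.trans {s : ℕ → ℕ} {i j k m n : ℕ} (h : IsSegMax s i j m)
    (h' : IsSegMax s j k n) : IsSegMax s i k (max m n) := by
  have hij := h.le
  have hjk := h'.le
  refine ⟨fun l h1 h2 => ?_, ?_⟩
  · rcases le_total l j with hl | hl
    · exact (h.1 l h1 hl).trans (le_max_left _ _)
    · exact (h'.1 l hl h2).trans (le_max_right _ _)
  · rcases le_total m n with hmn | hmn
    · obtain ⟨l, h1, h2, h3⟩ := h'.2
      exact ⟨l, hij.trans h1, h2, by rw [max_eq_right hmn, h3]⟩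
    · obtain ⟨l, h1, h2, h3⟩ := h.2
      exact ⟨l, h1, h2.trans hjk, by rw [max_eq_left hmn, h3]⟩

theorem exists_between_of_unbounded {f : ℕ → ℕ} (h0 : f 0 = 0) (hf : ∀ N, ∃ n, N ≤ f n)
    (k : ℕ) : ∃ n, f n ≤ k ∧ k < f (n + 1) := by
  by_contra hcon
  push Not at hcon
  have h : ∀ n, f n ≤ k := by
    intro n
    induction n with
    | zero => omega
    | succ n ih => exact hcon n ih
  obtain ⟨n, hn⟩ := hf (k + 1)
  have := h n
  omega

/-- A sequence of moves, some of which are silent (value `-1`), satisfies the parity condition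
if the other moves are infinitely many and dominate the segments of a sequence that satisfies
the parity condition. -/
theorem maxInfEven_of_dominates {s : ℕ → ℕ} {c : ℕ → ℤ} {t : ℕ → ℕ} {K : ℕ}
    (hs : MaxInfEven s) (hsK : ∀ n, s n ≤ K) (ht0 : t 0 = 0)
    (ht : ∀ N, ∃ n, N ≤ t n)
    (hc : ∀ n, (c (n + 1) = -1 ∧ t (n + 1) = t n) ∨ ∃ m m' : ℕ, c (n + 1) = m ∧ m ≤ K ∧
      IsSegMax s (t n) (t (n + 1)) m' ∧ Dominates m m') :
    MaxInfEven c := by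
  obtain ⟨M, hM, hMe⟩ := hs
  have hmono : Monotone t := monotone_nat_of_le_succ fun n => by
    rcases hc n with h | ⟨m, m', -, -, h, -⟩
    · exact h.2.ge
    · exact h.le
  obtain ⟨N, hN⟩ := Filter.eventually_atTop.1 (eventually_le_of_isGreatest hsK hM)
  obtain ⟨N', hN'⟩ := ht N
  have hbig : ∀ n ≥ N', ∀ m', IsSegMax s (t n) (t (n + 1)) m' → m' ≤ M := by
    rintro n hn m' ⟨-, k, hk, -, rfl⟩
    exact hN k (hN'.trans ((hmono hn).trans hk))
  have hfreq : ∃ᶠ n in Filter.atTop, Even (c n) ∧ (M : ℤ) ≤ c n ∧ c n ≤ K := by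
    rw [Filter.frequently_atTop]
    intro L
    -- An occurrence of `M` this late lies in a segment of index at least `L + N'`, where segment
    -- maxima no longer exceed `M`. So that segment has maximum exactly `M`, which is even, and the
    -- dominating move is even and at least `M`.
    obtain ⟨k, hk, hkM⟩ := Filter.frequently_atTop.1 hM.1 (t (L + N') + 1)
    obtain ⟨n, hn1, hn2⟩ := exists_between_of_unbounded ht0 ht k
    have hLn : L + N' ≤ n := by
      by_contra hlt
      have := hmono (show n + 1 ≤ L + N' by omega)
      omega
    refine ⟨n + 1, by omega, ?_⟩
    rcases hc n with h | ⟨m, m', h1, h2, h3, h4⟩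
    · omega
    · have h5 := hbig n (by omega) m' h3
      have h6 := h3.1 k hn1 hn2.le
      obtain rfl : m' = M := by omega
      obtain ⟨h7, h8⟩ := h4.1 hMe
      rw [h1]
      exact ⟨by exact_mod_cast h7, by exact_mod_cast h8, by exact_mod_cast h2⟩
  have hfin : (Set.Icc (M : ℤ) K).Finite := Set.finite_Icc _ _
  have hbound : ∀ n, c (n + 1) ≤ K := by
    intro n
    rcases hc n with h | ⟨m, m', h1, h2, -⟩ <;> omega
  have hle : ∀ k ∈ infOcc c, k ≤ K := by
    intro k hk
    obtain ⟨n, hn, rfl⟩ := Filter.frequently_atTop.1 hk 1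
    obtain ⟨n, rfl⟩ : ∃ l, n = l + 1 := ⟨n - 1, by omega⟩
    exact hbound n
  obtain ⟨k₀, ⟨hk₀, -⟩, hk₀'⟩ := exists_frequently_eq (s := c) hfin hfreq fun n hn => hn.2
  obtain ⟨E, ⟨hE1, hE2⟩, hEmax⟩ := Set.exists_max_image {k ∈ infOcc c | (M : ℤ) ≤ k} id
    (hfin.subset fun k hk => ⟨hk.2, hle k hk.1⟩) ⟨k₀, hk₀'.mono fun n hn => hn.2, hk₀⟩
  refine ⟨E, ⟨hE1, fun k hk => ?_⟩, ?_⟩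
  · rcases le_total (M : ℤ) k with h | h
    · exact hEmax k ⟨hk, h⟩
    · exact h.trans hE2
  · obtain ⟨n, hn, hnE⟩ := Filter.frequently_atTop.1 hE1 (N' + 1)
    obtain ⟨n, rfl⟩ : ∃ l, n = l + 1 := ⟨n - 1, by omega⟩
    rcases hc n with h | ⟨m, m', h1, h2, h3, h4⟩
    · omega
    · obtain rfl : (m : ℤ) = E := by rw [← hnE, h1]
      -- An odd value is at most the maximum of its segment, hence at most `M`; being at least `M`
      -- it equals `M`, which is even.
      by_contra hodd
      have ho : Odd m := Nat.not_even_iff_odd.1 fun h => hodd (by exact_mod_cast h)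
      have h5 := h4.2 ho
      have h6 := hbig n (by omega) m' h3
      obtain rfl : m = M := by omega
      exact hodd (by exact_mod_cast hMe)

/-! ### Computable functions are continuous -/

theorem OmegaMachine.pos_configAt_le {A B : Type*} (M : OmegaMachine A B) (α : OmegaWord A)
    (t : ℕ) : (M.configAt α t).pos ≤ t := by
  induction t with
  | zero => exact le_rfl
  | succ t ih =>
    simp only [OmegaMachine.configAt, OmegaMachine.next]
    split_ifs <;> omega

/-- The input head advances by at most one cell per step and starts on the delimiter, so the first
`t` steps see only the first `t` letters. -/
theorem OmegaMachine.configAt_congr {A B : Type*} (M : OmegaMachine A B) {α β : OmegaWord A}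
    {t : ℕ} (h : AgreeUpTo t α β) : M.configAt α t = M.configAt β t := by
  induction t with
  | zero => rfl
  | succ t ih =>
    have hcell : inputCell α (M.configAt β t).pos = inputCell β (M.configAt β t).pos := by
      have hle := M.pos_configAt_le β t
      rcases hp : (M.configAt β t).pos with _ | k
      · rfl
      · exact congrArg some (h k (by omega))
    simp only [OmegaMachine.configAt, ih (h.mono t.le_succ), OmegaMachine.next, hcell]

/-- Once the output has length `i`, at time `t` say, it has been determined by the first `t` input
letters; `t` serves as the modulus of continuity. -/
theorem IsComputableFn.isContinuousFn {A B : Type*} {f : OmegaWord A →. OmegaWord B}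
    (hf : IsComputableFn f) : IsContinuousFn f := by
  obtain ⟨M, hM⟩ := hf
  intro α x hx i
  obtain ⟨t, ht⟩ := (hM α x hx).2 i
  refine ⟨t, fun β y hy h => ?_⟩
  have h1 : (M.configAt α t).out = x.pref _ := (hM α x hx).1 t
  have h2 : (M.configAt β t).out = y.pref _ := (hM β y hy).1 t
  rw [← M.configAt_congr h] at h2
  exact (agreeUpTo_of_pref_eq (h1.symm.trans h2)).mono ht

/-! ### Runs of transducers -/

namespace Transducer

variable {A B Q : Type*}

theorem Run.append {T : Transducer A B Q} {p q r : Q} {u u' : List A} {v v' : List B}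
    {m n : ℕ} (h : T.Run p u v q m) (h' : T.Run q u' v' r n) :
    T.Run p (u ++ u') (v ++ v') r (max m n) := by
  induction h with
  | nil p =>
    -- The empty run contributes only its single state, which the second run visits as its first
    -- state.
    have hle : T.color p ≤ n := by
      cases h' with
      | nil => exact le_rfl
      | cons _ _ => exact le_max_left _ _
    rwa [max_eq_right hle]
  | cons hΔ _ ih =>
    rw [List.append_assoc, List.append_assoc, max_assoc]
    exact Run.cons hΔ (ih h')

theorem run_of_mem {T : Transducer A B Q} {p q : Q} {u : List A} {v : List B}
    (h : (p, u, v, q) ∈ T.Δ) : T.Run p u v q (max (T.color p) (T.color q)) := by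
  simpa using Run.cons h (Run.nil q)

theorem exists_run_segment (T : Transducer A B Q) {ρ : ℕ → Q} {u : ℕ → List A}
    {v : ℕ → List B} (hρ : ∀ n, (ρ n, u n, v n, ρ (n + 1)) ∈ T.Δ) {i j : ℕ} (hij : i ≤ j) :
    ∃ u' v' m, blocks u j = blocks u i ++ u' ∧ blocks v j = blocks v i ++ v' ∧
      IsSegMax (fun n => T.color (ρ n)) i j m ∧ T.Run (ρ i) u' v' (ρ j) m := by
  induction j, hij using Nat.le_induction with
  | base => exact ⟨[], [], _, by simp, by simp, isSegMax_self _ i, Run.nil _⟩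
  | succ j _ ih =>
    obtain ⟨u', v', m, hu, hv, hm, hr⟩ := ih
    exact ⟨u' ++ u j, v' ++ v j, _, by simp [blocks, hu], by simp [blocks, hv],
      hm.trans (isSegMax_succ _ j), hr.append (run_of_mem (hρ j))⟩

/-- `ρ` is the state sequence of an accepting run on `α` with output `x`, and `τ n` is the
time at which the run reads the letter `α n`. -/
structure IsTimedRun (T : Transducer A B Q) (α : OmegaWord A) (x : OmegaWord B) (ρ : ℕ → Q)
    (τ : ℕ → ℕ) : Prop where
  start : ρ 0 = T.start
  accepting : MaxInfEven fun n => T.color (ρ n)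
  le_time : ∀ n, n ≤ τ n
  input : ∀ n, ρ (τ n) ∈ T.inputStates
  segment_zero : ∃ m, IsSegMax (fun n => T.color (ρ n)) 0 (τ 0) m ∧
    (ρ 0, ρ (τ 0), m) ∈ T.profile []
  segment_succ : ∀ n, ∃ m, IsSegMax (fun n => T.color (ρ n)) (τ n) (τ (n + 1)) m ∧
    (ρ (τ n), ρ (τ (n + 1)), m) ∈ T.profile [α n]
  reach : ∀ n, ∃ k, ρ (τ n) ∈ T.reach T.start (α.pref n) (x.pref k)

theorem exists_isTimedRun (T : Transducer A B Q) {α : OmegaWord A} {x : OmegaWord B}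
    (h : (α, x) ∈ T.relation) : ∃ ρ τ, T.IsTimedRun α x ρ τ := by
  obtain ⟨ρ, u, v, h0, hΔ, hu, hv, hacc⟩ := h
  -- `τ n` is a step at which the amount of input read passes from at most `n` to more than `n`.
  -- Since a transition reads at most one letter, it is exactly `n` before that step.
  have hex := exists_between_of_unbounded (f := fun n => (blocks u n).length) rfl hu.2
  choose τ hτ1 hτ2 using hex
  have hlen : ∀ n, (u n).length ≤ 1 := by
    intro n
    by_cases hn : ρ n ∈ T.inputStates
    · exact (T.input_reads _ _ _ _ (hΔ n) hn).le
    · simp [T.output_reads _ _ _ _ (hΔ n) hn]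
  have hstep : ∀ n, (blocks u (n + 1)).length = (blocks u n).length + (u n).length := by
    simp [blocks]
  have hτ : ∀ n, (blocks u (τ n)).length = n := by
    intro n
    have h1 := hτ1 n
    have h2 := hτ2 n
    have h3 := hstep (τ n)
    have h4 := hlen (τ n)
    omega
  have hblk : ∀ n, blocks u (τ n) = α.pref n := by
    intro n
    have := hu.1 (τ n)
    rwa [IsOmegaPrefix, hτ] at this
  have hmono : Monotone fun n => (blocks u n).length :=
    monotone_nat_of_le_succ fun n => by simp [blocks]
  have hle : ∀ n, (blocks u n).length ≤ n := by
    intro n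
    induction n with
    | zero => exact le_rfl
    | succ n ih => have := hstep n; have := hlen n; omega
  have hτmono : ∀ n, τ n ≤ τ (n + 1) := by
    intro n
    by_contra hlt
    have := hmono (show τ (n + 1) ≤ τ n by omega)
    simp only [hτ] at this
    omega
  refine ⟨ρ, τ, h0, hacc, fun n => (hτ n).symm.trans_le (hle _), fun n => ?_, ?_, fun n => ?_,
    fun n => ?_⟩
  · by_contra hn
    have h1 := hstep (τ n)
    have h2 := hτ2 n
    have h3 := hτ n
    rw [T.output_reads _ _ _ _ (hΔ (τ n)) hn, List.length_nil] at h1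
    omega
  · obtain ⟨u', v', m, hu', -, hm, hr⟩ := T.exists_run_segment hΔ (Nat.zero_le (τ 0))
    rw [hblk] at hu'
    obtain rfl : u' = [] := by simpa [OmegaWord.pref, blocks] using hu'.symm
    exact ⟨m, hm, v', hr⟩
  · obtain ⟨u', v', m, hu', -, hm, hr⟩ := T.exists_run_segment hΔ (hτmono n)
    rw [hblk, hblk, α.pref_succ] at hu'
    obtain rfl := List.append_cancel_left hu'
    exact ⟨m, hm, v', hr⟩
  · obtain ⟨u', v', m, hu', hv', hm, hr⟩ := T.exists_run_segment hΔ (Nat.zero_le (τ n))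
    refine ⟨(blocks v (τ n)).length, m, ?_⟩
    have hpx : blocks v (τ n) = x.pref (blocks v (τ n)).length := hv.1 (τ n)
    rw [← hpx, ← hblk, hu', hv', ← h0]
    simpa [blocks] using hr

/-- The input state `p` is reached on the prefix of length `n` of `α` with an output that is a
prefix of `x`. -/
def AtInput (T : Transducer A B Q) (α : OmegaWord A) (x : OmegaWord B) (n : ℕ) (p : Q) :
    Prop :=
  p ∈ T.inputStates ∧ ∃ k, p ∈ T.reach T.start (α.pref n) (x.pref k)

/-- Both outputs are prefixes of the same `x`, so one is a prefix of the other and property P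
applies. -/
theorem AtInput.eq {T : Transducer A B Q} (hT : T.HasPropertyP) {α : OmegaWord A}
    {x : OmegaWord B} {n : ℕ} {p q : Q} (hp : T.AtInput α x n p) (hq : T.AtInput α x n q) :
    p = q := by
  obtain ⟨hp, k, hk⟩ := hp
  obtain ⟨hq, l, hl⟩ := hq
  rcases le_total k l with h | h
  · exact hT _ _ _ _ _ (x.pref_prefix h) hk hp hl hq
  · exact (hT _ _ _ _ _ (x.pref_prefix h) hl hq hk hp).symm

/-- By continuity, the input state reached on a prefix of `α` is determined by a longer
prefix of `α`. -/
theorem AtInput.exists_agreeUpTo {T : Transducer A B Q} {f : OmegaWord A →. OmegaWord B}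
    (hf : IsContinuousFn f) {α : OmegaWord A} {x : OmegaWord B} (hx : x ∈ f α) {n : ℕ} {p : Q}
    (hp : T.AtInput α x n p) :
    ∃ j, ∀ β y, y ∈ f β → AgreeUpTo j α β → T.AtInput β y n p := by
  obtain ⟨hp, k, hk⟩ := hp
  obtain ⟨j, hj⟩ := hf α x hx k
  -- Agreement up to `j` preserves the output prefix of length `k`; agreement up to `n` preserves
  -- the input prefix.
  refine ⟨max j n, fun β y hy h => ⟨hp, k, ?_⟩⟩
  rwa [← (h.mono (le_max_right _ _)).pref_eq,
    ← (hj β y hy (h.mono (le_max_left _ _))).pref_eq]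

end Transducer

/-! ### Strategies given by functions of plays -/

/-- A strategy may be given as a function of infinite sequences that depends only on the past; a
history is padded with the initial vertex to evaluate it. -/
theorem Game.eveHasWinningStrategy_of_prefix {V : Type*} (G : Game V)
    (F : (ℕ → V) → ℕ → V)
    (hF : ∀ γ γ' n, (∀ i ≤ n, γ i = γ' i) → F γ n = F γ' n)
    (hedge : ∀ γ n, G.owner (γ n) = Player.eve → G.Edge (γ n) (F γ n))
    (hwin : ∀ γ, G.IsPlay γ →
      (∀ n, G.owner (γ n) = Player.eve → γ (n + 1) = F γ n) → γ ∈ G.win) :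
    G.EveHasWinningStrategy := by
  refine ⟨fun h => F (fun i => h.getD i G.init) (h.length - 1), fun h v hh hv => ?_,
    fun γ hγ hc => hwin γ hγ fun n hn => ?_⟩
  · have hlast : h.getD (h.length - 1) G.init = v := by
      have := hh.2.2
      rw [List.getLast?_eq_getElem?] at this
      simp [List.getD_eq_getElem?_getD, this]
    have := hedge (fun i => h.getD i G.init) (h.length - 1)
    simp only [hlast] at this
    exact this hv
  · rw [hc n hn]
    simp only [List.length_map, List.length_range, Nat.add_sub_cancel]
    refine hF _ _ _ fun i hi => ?_
    simp [List.getD_eq_getElem?_getD, Nat.lt_succ_of_le hi]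

/-! ### Plays of the delay game -/

section DelayGame

variable {A B Q S : Type*} {T : Transducer A B Q} {D : DPA A S}

theorem DelayEdge.of_adam {v w : Vertex Q S} (h : DelayEdge T D v w)
    (hv : v.player = Player.adam) :
    ∃ a, w = ⟨v.state, -1, v.P₁, profileMul v.P₂ (T.profile [a]), D.step v.dom a,
      Player.eve⟩ := by
  cases h with
  | letter q c P₁ P₂ r a => exact ⟨a, rfl⟩
  | skip => cases hv
  | produce => cases hv

theorem DelayEdge.of_eve {v w : Vertex Q S} (h : DelayEdge T D v w)
    (hv : v.player = Player.eve) : w.player = Player.adam ∧ w.dom = v.dom := by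
  cases h with
  | letter => cases hv
  | skip => exact ⟨rfl, rfl⟩
  | produce => exact ⟨rfl, rfl⟩

/-! ### Eve's strategy -/

variable (T D) in
/-- A letter by which Adam moves from `v` to `w`. -/
noncomputable def moveLetter [Nonempty A] (v w : Vertex Q S) : A :=
  Classical.epsilon fun a => w = ⟨v.state, -1, v.P₁, profileMul v.P₂ (T.profile [a]),
    D.step v.dom a, Player.eve⟩

/-- A vertex records only a profile and an automaton state, so several letters may induce the same
move. Any of them explains the play equally well. -/
theorem DelayEdge.eq_moveLetter [Nonempty A] {v w : Vertex Q S} (h : DelayEdge T D v w)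
    (hv : v.player = Player.adam) :
    w = ⟨v.state, -1, v.P₁, profileMul v.P₂ (T.profile [moveLetter T D v w]),
      D.step v.dom (moveLetter T D v w), Player.eve⟩ :=
  Classical.epsilon_spec (h.of_adam hv)

variable (T D) in
/-- The input word given by Adam in a play. -/
noncomputable def playWord [Nonempty A] (γ : ℕ → Vertex Q S) : OmegaWord A :=
  fun j => moveLetter T D (γ (2 * j)) (γ (2 * j + 1))

/-- The number of input letters that had been given when Eve last produced. -/
def lastCut (γ : ℕ → Vertex Q S) : ℕ → ℕ
  | 0 => 0
  -- A producing edge has a nonnegative priority, so `-1` marks exactly the silent moves. By vertex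
  -- `n + 1`, `(n + 2) / 2` letters have been given.
  | n + 1 => if (γ (n + 1)).color = -1 then lastCut γ n else (n + 2) / 2

/-- Time in the run `τ` on the input word that corresponds to the state in the play. -/
def runTime (γ : ℕ → Vertex Q S) (τ : ℕ → ℕ) : ℕ → ℕ
  | 0 => 0
  -- Production consumes the first profile, which ends at the cut in force before the move.
  | n + 1 => if (γ (n + 1)).color = -1 then runTime γ τ n else τ (lastCut γ n)

variable (T D) in
/-- Eve may move to the state `x.1` with priority `x.2`: all words in the domain of `f` that
extend the current input lead to `x.1` on the input of the first profile, and `x.2` is the best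
priority (up to `K`) with which this state can be reached. -/
def IsGoodMove [Nonempty A] (f : OmegaWord A →. OmegaWord B) (K : ℕ) (γ : ℕ → Vertex Q S)
    (n : ℕ) (x : Q × ℕ) : Prop :=
  ((γ n).state, x.1, x.2) ∈ (γ n).P₁ ∧ x.2 ≤ K ∧
  (∀ m ≤ K, ((γ n).state, x.1, m) ∈ (γ n).P₁ → Dominates x.2 m) ∧
  ∀ β y, y ∈ f β → AgreeUpTo ((n + 1) / 2) (playWord T D γ) β →
    T.AtInput β y (lastCut γ n) x.1

variable (T D) in
open Classical in
/-- Eve's strategy: produce as soon as there is a good move. -/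
noncomputable def eveMove [Nonempty A] (f : OmegaWord A →. OmegaWord B) (K : ℕ)
    (γ : ℕ → Vertex Q S) (n : ℕ) : Vertex Q S :=
  if h : ∃ x, IsGoodMove T D f K γ n x then
    ⟨h.choose.1, h.choose.2, (γ n).P₂, T.profile [], (γ n).dom, Player.adam⟩
  else ⟨(γ n).state, -1, (γ n).P₁, (γ n).P₂, (γ n).dom, Player.adam⟩

theorem lastCut_congr {γ γ' : ℕ → Vertex Q S} {n : ℕ} (h : ∀ i ≤ n, γ i = γ' i) :
    lastCut γ n = lastCut γ' n := by
  induction n with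
  | zero => rfl
  | succ n ih =>
    simp only [lastCut, h (n + 1) le_rfl, ih fun i hi => h i (hi.trans n.le_succ)]

theorem eveMove_congr [Nonempty A] (f : OmegaWord A →. OmegaWord B) (K : ℕ)
    {γ γ' : ℕ → Vertex Q S} {n : ℕ} (h : ∀ i ≤ n, γ i = γ' i) :
    eveMove T D f K γ n = eveMove T D f K γ' n := by
  have hw : ∀ β, AgreeUpTo ((n + 1) / 2) (playWord T D γ) β ↔
      AgreeUpTo ((n + 1) / 2) (playWord T D γ') β := by
    intro β
    refine forall₂_congr fun k hk => ?_
    simp only [playWord, h (2 * k) (by omega), h (2 * k + 1) (by omega)]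
  have hg : IsGoodMove T D f K γ n = IsGoodMove T D f K γ' n := by
    funext x
    simp only [IsGoodMove, h n le_rfl, hw, lastCut_congr h]
  rw [eveMove, eveMove, h n le_rfl]
  -- The chosen witness depends on the predicate alone, so identifying the two predicates identifies
  -- the two choices.
  generalize IsGoodMove T D f K γ n = P at hg
  subst hg
  rfl

theorem edge_eveMove [Nonempty A] (f : OmegaWord A →. OmegaWord B) (K : ℕ)
    (γ : ℕ → Vertex Q S) (n : ℕ) (hn : (γ n).player = Player.eve) :
    DelayEdge T D (γ n) (eveMove T D f K γ n) := by
  have hv : γ n = ⟨(γ n).state, (γ n).color, (γ n).P₁, (γ n).P₂, (γ n).dom, Player.eve⟩ := by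
    rw [← hn]
  rw [eveMove]
  split_ifs with h
  · have hm := h.choose_spec.1
    generalize h.choose = x at hm ⊢
    generalize γ n = v at *
    rw [hv]
    exact DelayEdge.produce _ _ _ _ _ _ _ hm
  · generalize γ n = v at *
    rw [hv]
    exact DelayEdge.skip _ _ _ _ _

theorem player_of_isPlay {γ : ℕ → Vertex Q S} (hγ : (delayGame T D).IsPlay γ) (j : ℕ) :
    (γ (2 * j)).player = Player.adam ∧ (γ (2 * j + 1)).player = Player.eve := by
  have hodd : ∀ j, (γ (2 * j)).player = Player.adam →
      (γ (2 * j + 1)).player = Player.eve := by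
    intro j hj
    obtain ⟨a, ha⟩ := DelayEdge.of_adam (hγ.2 (2 * j)) hj
    rw [ha]
  have heven : (γ (2 * j)).player = Player.adam := by
    induction j with
    | zero =>
      have := hγ.1
      simp only [Nat.mul_zero, this, delayGame]
    | succ j ih => exact (DelayEdge.of_eve (hγ.2 (2 * j + 1)) (hodd j ih)).1
  exact ⟨heven, hodd j heven⟩

theorem dom_of_isPlay [Nonempty A] {γ : ℕ → Vertex Q S} (hγ : (delayGame T D).IsPlay γ)
    (n : ℕ) : (γ n).dom = D.run (playWord T D γ) ((n + 1) / 2) := by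
  induction n with
  | zero =>
    have := hγ.1
    simp [this, delayGame, DPA.run]
  | succ n ih =>
    obtain ⟨j, rfl | rfl⟩ := n.even_or_odd'
    · have h := DelayEdge.eq_moveLetter (hγ.2 (2 * j)) (player_of_isPlay hγ j).1
      rw [h]
      simp only [ih]
      rw [show (2 * j + 1 + 1) / 2 = j + 1 by omega, show (2 * j + 1) / 2 = j by omega]
      rfl
    · rw [(DelayEdge.of_eve (hγ.2 (2 * j + 1)) (player_of_isPlay hγ j).2).2, ih]
      congr 1
      omega

theorem playWord_mem_language [Nonempty A] {γ : ℕ → Vertex Q S}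
    (hγ : (delayGame T D).IsPlay γ) (h : MaxInfEven fun n => D.color (γ n).dom) :
    playWord T D γ ∈ D.language := by
  simp only [dom_of_isPlay hγ] at h
  unfold MaxInfEven at h
  rwa [infOcc_comp_half fun j => D.color (D.run (playWord T D γ) j)] at h

/-! ### Comparison of the play with an accepting run -/

/-- The relation between a play and a run on its input word that is kept by Eve's strategy. -/
structure Follows (T : Transducer A B Q) (γ : ℕ → Vertex Q S) (ρ : ℕ → Q) (τ : ℕ → ℕ)
    (n : ℕ) : Prop where
  state : (γ n).state = ρ (runTime γ τ n)
  first : ∃ m, IsSegMax (fun n => T.color (ρ n)) (runTime γ τ n) (τ (lastCut γ n)) m ∧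
    (ρ (runTime γ τ n), ρ (τ (lastCut γ n)), m) ∈ (γ n).P₁
  second : ∃ m, IsSegMax (fun n => T.color (ρ n)) (τ (lastCut γ n)) (τ ((n + 1) / 2)) m ∧
    (ρ (τ (lastCut γ n)), ρ (τ ((n + 1) / 2)), m) ∈ (γ n).P₂

variable [Nonempty A] {f : OmegaWord A →. OmegaWord B} {K : ℕ} {γ : ℕ → Vertex Q S}
  {x : OmegaWord B} {ρ : ℕ → Q} {τ : ℕ → ℕ}

theorem eveMove_of_consistent
    (hγ : (delayGame T D).IsPlay γ)
    (hc : ∀ n, (γ n).player = Player.eve → γ (n + 1) = eveMove T D f K γ n) (j : ℕ) :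
    γ (2 * j + 1 + 1) = eveMove T D f K γ (2 * j + 1) :=
  hc _ (player_of_isPlay hγ j).2

theorem isTimedRun_atInput (hρ : T.IsTimedRun (playWord T D γ) x ρ τ) (n : ℕ) :
    T.AtInput (playWord T D γ) x n (ρ (τ n)) :=
  ⟨hρ.input n, hρ.reach n⟩

/-- The play's own word is one of the words over which a good move quantifies, so the target and the
state of the run are both reached at the last cut; property P identifies them. -/
theorem IsGoodMove.eq (hT : T.HasPropertyP) (hx : x ∈ f (playWord T D γ))
    (hρ : T.IsTimedRun (playWord T D γ) x ρ τ) {n : ℕ} {y : Q × ℕ}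
    (hy : IsGoodMove T D f K γ n y) : y.1 = ρ (τ (lastCut γ n)) :=
  (hy.2.2.2 _ x hx fun _ _ => rfl).eq hT (isTimedRun_atInput hρ _)

/-- The run is fixed only after the play, and the strategy never refers to it. The delicate case is
production: the target is the run's state by `IsGoodMove.eq`, the old second profile becomes the
first, and the new second one holds the empty segment. -/
theorem follows (hT : T.HasPropertyP) (hγ : (delayGame T D).IsPlay γ)
    (hc : ∀ n, (γ n).player = Player.eve → γ (n + 1) = eveMove T D f K γ n)
    (hx : x ∈ f (playWord T D γ)) (hρ : T.IsTimedRun (playWord T D γ) x ρ τ) (n : ℕ) :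
    Follows T γ ρ τ n := by
  have hself : ∀ k, (ρ k, ρ k, T.color (ρ k)) ∈ T.profile [] :=
    fun k => ⟨[], Transducer.Run.nil _⟩
  induction n with
  | zero =>
    have h0 := hγ.1
    refine ⟨?_, ?_, ?_⟩
    · simp only [h0, delayGame, runTime, hρ.start]
    -- Even with no input given, the run may pass through output states before its first input
    -- state; the profile of the empty word contains this segment.
    · simpa only [h0, delayGame, runTime, lastCut] using hρ.segment_zero
    · simp only [h0, delayGame, lastCut]
      exact ⟨_, isSegMax_self _ _, hself _⟩
  | succ n ih =>
    obtain ⟨j, rfl | rfl⟩ := n.even_or_odd'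
    · have h := DelayEdge.eq_moveLetter (hγ.2 (2 * j)) (player_of_isPlay hγ j).1
      change _ = Vertex.mk _ _ _ (profileMul _ (T.profile [playWord T D γ j])) _ _ at h
      have hcol : (γ (2 * j + 1)).color = -1 := by rw [h]
      have hcut : lastCut γ (2 * j + 1) = lastCut γ (2 * j) := if_pos hcol
      have htime : runTime γ τ (2 * j + 1) = runTime γ τ (2 * j) := if_pos hcol
      refine ⟨?_, ?_, ?_⟩
      · rw [htime, ← ih.state, h]
      · rw [htime, hcut, h]
        exact ih.first
      · obtain ⟨m, hm, hm'⟩ := ih.second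
        obtain ⟨l, hl, hl'⟩ := hρ.segment_succ j
        rw [show (2 * j + 1) / 2 = j by omega] at hm hm'
        rw [hcut, show (2 * j + 1 + 1) / 2 = j + 1 by omega, h]
        exact ⟨_, hm.trans hl, _, m, l, hm', hl', rfl⟩
    · have h := eveMove_of_consistent hγ hc j
      generalize hn : 2 * j + 1 = n at *
      have hn2 : (n + 1 + 1) / 2 = (n + 1) / 2 := by omega
      rw [eveMove] at h
      split_ifs at h with hg
      · have heq := hg.choose_spec.eq hT hx hρ
        generalize hg.choose = y at h heq
        have hcol : (γ (n + 1)).color ≠ -1 := by rw [h]; simp only; omega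
        have hcut : lastCut γ (n + 1) = (n + 1) / 2 := (if_neg hcol).trans hn2
        have htime : runTime γ τ (n + 1) = τ (lastCut γ n) := if_neg hcol
        refine ⟨?_, ?_, ?_⟩
        · rw [htime, ← heq, h]
        · rw [htime, hcut, h]
          exact ih.second
        · rw [hcut, hn2, h]
          exact ⟨_, isSegMax_self _ _, hself _⟩
      · have hcol : (γ (n + 1)).color = -1 := by rw [h]
        have hcut : lastCut γ (n + 1) = lastCut γ n := if_pos hcol
        have htime : runTime γ τ (n + 1) = runTime γ τ n := if_pos hcol
        refine ⟨?_, ?_, ?_⟩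
        · rw [htime, ← ih.state, h]
        · rw [htime, hcut, h]
          exact ih.first
        · rw [hcut, hn2, h]
          exact ih.second

/-- Only Eve's productions are not silent. For these, the maximum of the run on the traced segment
occurs in the first profile by `follows`, so it is among the priorities that the chosen one
dominates. -/
theorem move_dominates (hT : T.HasPropertyP) (hK : ∀ q, T.color q ≤ K)
    (hγ : (delayGame T D).IsPlay γ)
    (hc : ∀ n, (γ n).player = Player.eve → γ (n + 1) = eveMove T D f K γ n)
    (hx : x ∈ f (playWord T D γ)) (hρ : T.IsTimedRun (playWord T D γ) x ρ τ) (n : ℕ) :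
    ((γ (n + 1)).color = -1 ∧ runTime γ τ (n + 1) = runTime γ τ n) ∨
    ∃ m m' : ℕ, (γ (n + 1)).color = m ∧ m ≤ K ∧
      IsSegMax (fun n => T.color (ρ n)) (runTime γ τ n) (runTime γ τ (n + 1)) m' ∧
      Dominates m m' := by
  by_cases hcol : (γ (n + 1)).color = -1
  · exact Or.inl ⟨hcol, if_pos hcol⟩
  right
  have htime : runTime γ τ (n + 1) = τ (lastCut γ n) := if_neg hcol
  obtain ⟨j, rfl | rfl⟩ := n.even_or_odd'
  · obtain ⟨a, ha⟩ := DelayEdge.of_adam (hγ.2 (2 * j)) (player_of_isPlay hγ j).1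
    exact absurd (by rw [ha]) hcol
  · have h := eveMove_of_consistent hγ hc j
    rw [eveMove] at h
    split_ifs at h with hg
    · have hy := hg.choose_spec
      have heq := hy.eq hT hx hρ
      generalize hg.choose = y at h heq hy
      have hfol := follows hT hγ hc hx hρ (2 * j + 1)
      obtain ⟨m', hm1, hm2⟩ := hfol.first
      refine ⟨y.2, m', by rw [h], hy.2.1, by rwa [htime], hy.2.2.1 m' ?_ ?_⟩
      · obtain ⟨k, -, -, rfl⟩ := hm1.2
        exact hK _
      · rwa [heq, hfol.state]
    · exact absurd (by rw [h]) hcol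

/-- Eve produces infinitely often. -/
theorem exists_color_ne (hT : T.HasPropertyP) (hf : IsContinuousFn f)
    (hK : ∀ q, T.color q ≤ K) (hγ : (delayGame T D).IsPlay γ)
    (hc : ∀ n, (γ n).player = Player.eve → γ (n + 1) = eveMove T D f K γ n)
    (hx : x ∈ f (playWord T D γ)) (hρ : T.IsTimedRun (playWord T D γ) x ρ τ) (N : ℕ) :
    ∃ n, N ≤ n ∧ (γ (n + 1)).color ≠ -1 := by
  by_contra hcon
  push Not at hcon
  have hcut : ∀ n, N ≤ n → lastCut γ n = lastCut γ N := by
    intro n hn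
    induction n, hn using Nat.le_induction with
    | base => rfl
    | succ n hn ih => exact (if_pos (hcon n hn)).trans ih
  -- Without further productions the cut is frozen, so a single `j` from continuity settles the
  -- state at the cut for good.
  obtain ⟨j, hj⟩ := (isTimedRun_atInput hρ (lastCut γ N)).exists_agreeUpTo hf hx
  -- A vertex of Eve beyond `N` at which `j + N + 1` letters are known, enough to decide that state.
  set n := 2 * (j + N) + 1 with hn
  have hcutn := hcut n (by omega)
  have hfol := follows hT hγ hc hx hρ n
  obtain ⟨m', hm1, hm2⟩ := hfol.first
  have hm'K : m' ≤ K := by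
    obtain ⟨k, -, -, rfl⟩ := hm1.2
    exact hK _
  rw [← hfol.state] at hm2
  -- The bound `K` makes the set of candidates finite, and the run's own segment maximum shows that
  -- it is nonempty.
  obtain ⟨m, ⟨hmK, hm⟩, hdom⟩ := exists_dominates
    (F := {m | m ≤ K ∧ ((γ n).state, ρ (τ (lastCut γ n)), m) ∈ (γ n).P₁})
    ((Set.finite_Iic K).subset fun m hm => hm.1) ⟨m', hm'K, hm2⟩
  have hg : ∃ y, IsGoodMove T D f K γ n y := by
    refine ⟨(ρ (τ (lastCut γ n)), m), hm, hmK, fun l hl hl' => hdom l ⟨hl, hl'⟩,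
      fun β y hy hag => ?_⟩
    rw [hcutn]
    exact hj β y hy (hag.mono (by omega))
  have h := eveMove_of_consistent hγ hc (j + N)
  rw [← hn, eveMove, dif_pos hg] at h
  have := hcon n (by omega)
  rw [h] at this
  simp only at this
  omega

/-- Two productions are needed: a late one pushes the cut beyond `N`, and the next one moves the
traced state up to that cut. The run reads letter `n` no earlier than time `n`. -/
theorem exists_le_runTime (hT : T.HasPropertyP) (hf : IsContinuousFn f)
    (hK : ∀ q, T.color q ≤ K) (hγ : (delayGame T D).IsPlay γ)
    (hc : ∀ n, (γ n).player = Player.eve → γ (n + 1) = eveMove T D f K γ n)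
    (hx : x ∈ f (playWord T D γ)) (hρ : T.IsTimedRun (playWord T D γ) x ρ τ) (N : ℕ) :
    ∃ n, N ≤ runTime γ τ n := by
  have hprod := exists_color_ne hT hf hK hγ hc hx hρ
  obtain ⟨k, hk, hk'⟩ := hprod (2 * N)
  have hcut : ∀ n, k + 1 ≤ n → N ≤ lastCut γ n := by
    intro n hn
    induction n, hn using Nat.le_induction with
    | base => rw [lastCut, if_neg hk']; omega
    | succ n hn ih => rw [lastCut]; split_ifs <;> omega
  obtain ⟨n, hn, hn'⟩ := hprod (k + 1)
  refine ⟨n + 1, ?_⟩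
  rw [runTime, if_neg hn']
  exact (hcut n hn).trans (hρ.le_time _)

end DelayGame

/-- A continuous uniformizer yields a winning strategy of Eve in the delay game. -/
theorem eveHasWinningStrategy_of_isContinuousFn {A B Q S : Type*} [Finite Q]
    {T : Transducer A B Q} (hT : T.HasPropertyP) {D : DPA A S}
    (hD : D.language = relDom T.relation) {f : OmegaWord A →. OmegaWord B}
    (hf : Uniformizes f T.relation) (hcont : IsContinuousFn f) :
    (delayGame T D).EveHasWinningStrategy := by
  cases isEmpty_or_nonempty A with
  | inl hA =>
    -- Adam has no first move over the empty alphabet, so there are no plays and always skipping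
    -- wins vacuously.
    refine (delayGame T D).eveHasWinningStrategy_of_prefix
      (fun γ n => ⟨(γ n).state, -1, (γ n).P₁, (γ n).P₂, (γ n).dom, Player.adam⟩)
      (fun γ γ' n h => by simp only [h n le_rfl]) (fun γ n hn => ?_) (fun γ hγ _ => ?_)
    · rcases hv : γ n with ⟨q, c, P₁, P₂, r, p⟩
      rw [hv] at hn
      obtain rfl : p = Player.eve := hn
      exact DelayEdge.skip q c P₁ P₂ r
    · obtain ⟨a, -⟩ := DelayEdge.of_adam (hγ.2 (2 * 0)) (player_of_isPlay hγ 0).1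
      exact hA.elim a
  | inr hA =>
    obtain ⟨K, hK⟩ := (Set.finite_range T.color).bddAbove
    replace hK : ∀ q, T.color q ≤ K := fun q => hK ⟨q, rfl⟩
    refine (delayGame T D).eveHasWinningStrategy_of_prefix (eveMove T D f K)
      (fun γ γ' n h => eveMove_congr f K h) (edge_eveMove f K) fun γ hγ hc hdom => ?_
    -- The premise of the winning condition says that the automaton accepts Adam's word, which
    -- therefore lies in `dom f`; only now can a run on its image under `f` be picked.
    have hα := playWord_mem_language hγ hdom
    rw [hD, ← hf.1] at hα
    have hx := Part.get_mem hα
    obtain ⟨ρ, τ, hρ⟩ := T.exists_isTimedRun (hf.2 _ _ hx)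
    exact maxInfEven_of_dominates hρ.accepting (fun n => hK _) rfl
      (exists_le_runTime hT hcont hK hγ hc hx hρ) (move_dominates hT hK hγ hc hx hρ)

end OmegaSynth

theorem mainTheorem4 {A B Q S : Type*} [Finite A] [Finite B] [Finite Q] [Finite S]
    (T : OmegaSynth.Transducer A B Q) (hT : T.HasPropertyP)
    (D : OmegaSynth.DPA A S) (hD : D.language = OmegaSynth.relDom T.relation) :
    ((∃ f : OmegaSynth.OmegaWord A →. OmegaSynth.OmegaWord B,
        OmegaSynth.Uniformizes f T.relation ∧ OmegaSynth.IsContinuousFn f) →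
      (OmegaSynth.delayGame T D).EveHasWinningStrategy) ∧
    ((∃ f : OmegaSynth.OmegaWord A →. OmegaSynth.OmegaWord B,
        OmegaSynth.Uniformizes f T.relation ∧ OmegaSynth.IsComputableFn f) →
      (OmegaSynth.delayGame T D).EveHasWinningStrategy) :=
  ⟨fun ⟨_, hf, hc⟩ => OmegaSynth.eveHasWinningStrategy_of_isContinuousFn hT hD hf hc,
    fun ⟨_, hf, hc⟩ =>
      OmegaSynth.eveHasWinningStrategy_of_isContinuousFn hT hD hf hc.isContinuousFn⟩
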